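/- Let $n,L,r\ge 1$ be integers, $t_l=l/L$ for $l=1,\dots,L$, and let $H\in\mathbb R^{L\times L}$ be an orthogonal matrix. Fix $\nu_1,\nu_2,K_1,K_2>0$. For $f:[0,1]^3\to[0,1]$ put $v(x,y)=H\,(f(x,y,t_1),\dots,f(x,y,t_L))^T$. Let $\Sigma=\Sigma(\nu_1,\nu_2,K_1,K_2)$ be the class of functions $f:[0,1]^3\to[0,1]$ with $f(x,y,t)=f(y,x,t)$ for which there are $0=\beta_0<\beta_1<\dots<\beta_r=1$ such that, for all $1\le i,j\le r$, all $x,x'$ in the $i$-th piece and all $y,y'$ in the $j$-th piece, $$[v_l(x,y)-v_l(x',y')]^2\le K_1\,[|x-x'|+|y-y'|]^{2\nu_1}\quad(1\le l\le L),\qquad \sum_{l=1}^L (l-1)^{2\nu_2}v_l^2(x,y)\le K_2,$$ where the $i$-th piece is $(\beta_{i-1},\beta_i]$, the point $0$ being included in the first piece. Let $\zeta=(\zeta_1,\dots,\zeta_n)$ have an arbitrary distribution on $[0,1]^n$, let $\Lambda^*_{i,j,l}=f(\zeta_i,\zeta_j,t_l)$ for $i\ne j$ and $\Lambda^*_{i,i,l}=0$.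 Given $\zeta$, one observes independent Bernoulli variables $A_{(i,j),l}$ with success probabilities $\Lambda^*_{i,j,l}$, $1\le i<j\le n$, $1\le l\le L$; they form a matrix $A\in\{0,1\}^{N\times L}$ with $N=n(n-1)/2$. Put $X=AH^T$. For $1\le m\le n$ and a map $z:\{1,\dots,n\}\to\{1,\dots,m\}$ let $Z\in\{0,1\}^{N\times m(m+1)/2}$ be the matrix whose entry for a pair of nodes $i<j$ and an unordered pair of classes $\{k,k'\}$ is $1$ if $\{z(i),z(j)\}=\{k,k'\}$ and $0$ otherwise. Let $(\hat m,\hat\rho,\hat V,\hat Z)$ be any minimizer of $$\|X-ZV\|^2+11\,n\log m+\tfrac{11}{2}\,m^2L^{\rho}\log(25L^{1-\rho})$$ over $1\le m\le n$, all such $Z$, all $\rho\in(0,1]$ for which $L^\rho$ is an integer, and all $V\in\mathbb R^{(m(m+1)/2)\times L}$ whose columns with index greater than $L^\rho$ are zero; here $\|\cdot\|$ is the Frobenius norm. Let $\hat\Lambda$ be the symmetric tensor with zero diagonal whose entries above the diagonal are those of $\hat\Theta=\hat Z\hat VH$. With $\|T\|^2=\sum_{i,j,l}T_{i,j,l}^2$,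 $$\sup_{f\in\Sigma}\frac{\mathbb E\|\hat\Lambda-\Lambda^*\|^2}{n^2L}\le C\min_{\substack{1\le h\le n-r\\ 0\le\rho\le1}}\left\{\frac{L^{\rho-1}}{h^{2\nu_1}}+\frac{I(\rho<1)}{L^{2\rho\nu_2+1}}+\frac{(h+r)^2\,(1+(1-\rho)\log L)}{n^2L^{1-\rho}}+\frac{\log(h+r)}{nL}\right\},$$ where $h$ ranges over integers, $\rho$ over reals, the expectation is over $\zeta$ and $A$, and the constant $C$ depends only on $\nu_1,\nu_2,K_1,K_2$. -/

import Mathlib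

open MeasureTheory ProbabilityTheory
open scoped ENNReal unitInterval

namespace DynGraphon

/-- Unordered pairs of distinct nodes, represented as `(i, j)` with `i < j`. -/
abbrev NodePair (n : ℕ) : Type := {p : Fin n × Fin n // p.1 < p.2}

/-- A three-way array indexed by two nodes and a time. -/
abbrev Tensor (n L : ℕ) : Type := Fin n → Fin n → Fin L → ℝ

/-- The observation: one bit for every pair `i < j` and every time. These are the entries of the
symmetric adjacency tensor above its (zero) diagonal. -/
abbrev Obs (n L : ℕ) : Type := NodePair n × Fin L → Bool

/-- The `l`-th observation time `l / L` (here `l` is counted from `0`). -/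
noncomputable def timePoint {L : ℕ} (l : Fin L) : I :=
  ⟨((l : ℝ) + 1) / L, by
    have hL : (0 : ℝ) < L := by exact_mod_cast l.pos
    have hl : (l : ℝ) + 1 ≤ L := by exact_mod_cast l.isLt
    exact ⟨by positivity, (div_le_one hL).2 hl⟩⟩

/-- The transform `v(x, y) = H (f(x, y, t_1), …, f(x, y, t_L))ᵀ`. -/
noncomputable def coeff {L : ℕ} (H : Matrix (Fin L) (Fin L) ℝ) (f : I → I → I → I) (x y : I) :
    Fin L → ℝ :=
  H.mulVec fun l => (f x y (timePoint l) : ℝ)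

/-- The `i`-th piece `(β_i, β_{i+1}]` of `[0, 1]`; the first piece also contains `0`. -/
def piece {r : ℕ} (β : Fin (r + 1) → ℝ) (i : Fin r) : Set I :=
  {x | ((i : ℕ) = 0 ∨ β i.castSucc < (x : ℝ)) ∧ (x : ℝ) ≤ β i.succ}

/-- Dynamic graphons with `r` pieces: symmetric in the two space variables, with coefficients `v_l`
piecewise Hölder in space and with Sobolev-type decay in `l`. The index `l` is counted from `0`. -/
def graphonClass {L : ℕ} (H : Matrix (Fin L) (Fin L) ℝ) (r : ℕ) (ν₁ ν₂ K₁ K₂ : ℝ) :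
    Set (I → I → I → I) :=
  {f | (∀ x y t, f x y t = f y x t) ∧
    ∃ β : Fin (r + 1) → ℝ, StrictMono β ∧ β 0 = 0 ∧ β (Fin.last r) = 1 ∧
      ∀ i j : Fin r, ∀ x ∈ piece β i, ∀ x' ∈ piece β i, ∀ y ∈ piece β j, ∀ y' ∈ piece β j,
        (∀ l, (coeff H f x y l - coeff H f x' y' l) ^ 2 ≤
          K₁ * (|(x : ℝ) - x'| + |(y : ℝ) - y'|) ^ (2 * ν₁)) ∧
        ∑ l : Fin L, (l : ℝ) ^ (2 * ν₂) * coeff H f x y l ^ 2 ≤ K₂}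

/-- The true tensor `Λ*_{ijl} = f(ζ_i, ζ_j, t_l)` for `i ≠ j`, with zero diagonal. -/
noncomputable def trueTensor {n : ℕ} (L : ℕ) (f : I → I → I → I) (ζ : Fin n → I) : Tensor n L :=
  fun i j l => if i = j then 0 else (f (ζ i) (ζ j) (timePoint l) : ℝ)

/-- The law of the observation given the latent positions `ζ`: independent Bernoulli entries with
success probabilities `f(ζ_i, ζ_j, t_l)`. -/
noncomputable def obsLaw {n : ℕ} (L : ℕ) (f : I → I → I → I) (ζ : Fin n → I) :
    Measure (Obs n L) :=
  Measure.pi fun q => bernoulliMeasure true false (f (ζ q.1.1.1) (ζ q.1.1.2) (timePoint q.2))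

/-- The data matrix `A ∈ {0,1}^{N × L}`, `N = n(n-1)/2`. -/
def dataMatrix {n L : ℕ} (a : Obs n L) : Matrix (NodePair n) (Fin L) ℝ :=
  Matrix.of fun p l => if a (p, l) then 1 else 0

/-- The clustering matrix of pairs of nodes into unordered pairs of classes that is induced by the
class labels `z`. -/
def clusterMatrix {n m : ℕ} (z : Fin n → Fin m) : Matrix (NodePair n) (Sym2 (Fin m)) ℝ :=
  Matrix.of fun p s => if s(z p.1.1, z p.1.2) = s then 1 else 0

/-- Packing of an `N × L` matrix into a symmetric tensor with zero diagonal. -/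
def pack {n L : ℕ} (Θ : Matrix (NodePair n) (Fin L) ℝ) : Tensor n L := fun i j l =>
  if h : i < j then Θ ⟨(i, j), h⟩ l else if h' : j < i then Θ ⟨(j, i), h'⟩ l else 0

/-- Squared Frobenius norm of a matrix. -/
def frobSq {α β : Type} [Fintype α] [Fintype β] (B : Matrix α β ℝ) : ℝ := ∑ i, ∑ j, B i j ^ 2

/-- Squared norm of a tensor. -/
def tensorNormSq {n L : ℕ} (T : Tensor n L) : ℝ := ∑ i, ∑ j, ∑ l, T i j l ^ 2

/-- The admissible exponents: `ρ ∈ (0, 1]` such that `L ^ ρ` is an integer. -/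
def rhoSet (L : ℕ) : Set ℝ := {ρ | 0 < ρ ∧ ρ ≤ 1 ∧ ∃ k : ℕ, (L : ℝ) ^ ρ = k}

/-- A candidate `(m, ρ, V, Z)` of the optimization problem. The coefficient matrix `V`, with rows
indexed by unordered pairs of classes, vanishes outside its first `L ^ ρ` columns. -/
structure Candidate (n L : ℕ) where
  m : ℕ
  one_le_m : 1 ≤ m
  m_le_n : m ≤ n
  ρ : ℝ
  rho_mem : ρ ∈ rhoSet L
  z : Fin n → Fin m
  V : Matrix (Sym2 (Fin m)) (Fin L) ℝ
  V_eq_zero : ∀ s (l : Fin L), (L : ℝ) ^ ρ ≤ (l : ℝ) → V s l = 0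

/-- The penalized least squares criterion, in the transformed data `X = A Hᵀ`. -/
noncomputable def objective {n L : ℕ} (H : Matrix (Fin L) (Fin L) ℝ) (a : Obs n L)
    (c : Candidate n L) : ℝ :=
  frobSq (dataMatrix a * H.transpose - clusterMatrix c.z * c.V)
    + 11 * n * Real.log c.m
    + 11 / 2 * (c.m : ℝ) ^ 2 * (L : ℝ) ^ c.ρ * Real.log (25 * (L : ℝ) ^ (1 - c.ρ))

/-- The tensor `Λ` obtained from a candidate by packing `Θ = Z V H`. -/
noncomputable def Candidate.tensor {n L : ℕ} (H : Matrix (Fin L) (Fin L) ℝ) (c : Candidate n L) :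
    Tensor n L :=
  pack (clusterMatrix c.z * c.V * H)

/-- `est` is a penalized least squares estimator: for every observation its value comes from a
global minimizer of the criterion. -/
def IsEstimator {n L : ℕ} (H : Matrix (Fin L) (Fin L) ℝ) (est : Obs n L → Tensor n L) : Prop :=
  ∀ a, ∃ c : Candidate n L, (∀ c', objective H a c ≤ objective H a c') ∧ est a = c.tensor H

/-- The normalized risk `E ‖Λ̂ - Λ*‖² / (n² L)`; the expectation is over the latent positions
`ζ ~ Pζ` and over the observation given `ζ`. -/
noncomputable def risk {n L : ℕ} (Pζ : Measure (Fin n → I)) (f : I → I → I → I)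
    (est : Obs n L → Tensor n L) : ℝ≥0∞ :=
  ∫⁻ ζ, ∫⁻ a, ENNReal.ofReal (tensorNormSq (est a - trueTensor L f ζ) / ((n : ℝ) ^ 2 * L))
    ∂(obsLaw L f ζ) ∂Pζ

/-- The sum of the four terms of the upper bound. -/
noncomputable def rate (n L r : ℕ) (ν₁ ν₂ : ℝ) (h : ℕ) (ρ : ℝ) : ℝ :=
  (L : ℝ) ^ (ρ - 1) / (h : ℝ) ^ (2 * ν₁)
    + (if ρ < 1 then 1 else 0) / (L : ℝ) ^ (2 * ρ * ν₂ + 1)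
    + ((h : ℝ) + r) ^ 2 * (1 + (1 - ρ) * Real.log L) / ((n : ℝ) ^ 2 * (L : ℝ) ^ (1 - ρ))
    + Real.log ((h : ℝ) + r) / (n * L)

end DynGraphon

/-! Since `H` is orthogonal, the criterion is penalized least squares for `A` itself over the
matrices `Z V H`. Comparing its minimizer with a fixed candidate bounds the squared error by the
candidate's error and penalty plus a noise term `2⟨error, noise⟩` minus the selected penalty. The
error lies in a subspace determined by the true matrix, the labels `z` and the cutoff `k = L ^ ρ`,
of dimension at most `m² k + 1`. So only the squared norm of the noise projected to it matters. Its
exponential moment is at most `√2 ^ dim` (`integral_exp_norm_sq_proj_noise_le`), and the penalty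
pays for a union over all `m`, `k` and the `m ^ n` labelings (`integral_excess_le`). This gives the
oracle inequality `integral_tensorNormSq_le` for every fixed `ζ`. For the bias, `exists_candidate`
clusters the nodes by a grid of width `1 / h` refined by the pieces and keeps the first `k ≈ L ^ ρ`
coefficients: Hölder regularity controls those kept, Sobolev decay those dropped. All bounds are
uniform in `ζ`, so its law plays no role. -/

namespace DynGraphon

/-! ### Exponential moments of Bernoulli noise -/

section BernoulliNoise

variable {ι : Type*} [Fintype ι]

/-- The product of Bernoulli laws on `{0, 1}^ι` with success probabilities `p`. -/
noncomputable def bernoulliPi (p : ι → I) : Measure (ι → Bool) :=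
  Measure.pi fun q => bernoulliMeasure true false (p q)

instance (p : ι → I) : IsProbabilityMeasure (bernoulliPi p) := by
  unfold bernoulliPi; infer_instance

/-- The vector of centred Bernoulli variables. -/
noncomputable def noise (p : ι → I) (a : ι → Bool) : EuclideanSpace ℝ ι :=
  WithLp.toLp 2 fun q => (if a q then 1 else 0) - (p q : ℝ)

/-- Hoeffding's lemma: a variable with values in `[0, 1]` has variance proxy `1 / 4`. -/
theorem integral_exp_bernoulli_le (p : I) (t : ℝ) :
    ∫ b, Real.exp (t * ((if b then 1 else 0) - (p : ℝ))) ∂(bernoulliMeasure true false p) ≤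
      Real.exp (t ^ 2 / 8) := by
  have h := hasSubgaussianMGF_of_mem_Icc (μ := bernoulliMeasure true false p)
    (X := fun b : Bool => if b then (1 : ℝ) else 0) (a := 0) (b := 1)
    (Measurable.of_discrete).aemeasurable (by
      refine Filter.Eventually.of_forall fun b => ?_
      cases b <;> simp)
  have hmean : ∫ b : Bool, (if b then (1 : ℝ) else 0) ∂(bernoulliMeasure true false p) = p := by
    rw [integral_bernoulliMeasure]; simp
  have h2 := h.mgf_le t
  rw [hmean] at h2
  refine h2.trans (Real.exp_le_exp.2 ?_)
  simp
  nlinarith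

theorem integral_exp_inner_noise_le (p : ι → I) (u : EuclideanSpace ℝ ι) :
    ∫ a, Real.exp (inner ℝ u (noise p a)) ∂(bernoulliPi p) ≤ Real.exp (‖u‖ ^ 2 / 8) := by
  have h1 : ∀ a, Real.exp (inner ℝ u (noise p a)) =
      ∏ q, Real.exp (u q * ((if a q then 1 else 0) - (p q : ℝ))) := by
    intro a
    rw [← Real.exp_sum]
    congr 1
    simp [PiLp.inner_apply, noise, mul_comm]
  simp_rw [h1]
  rw [bernoulliPi, integral_fintype_prod_eq_prod
    (f := fun q (b : Bool) => Real.exp (u q * ((if b then 1 else 0) - (p q : ℝ))))]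
  have h2 : Real.exp (‖u‖ ^ 2 / 8) = ∏ q, Real.exp (u q ^ 2 / 8) := by
    rw [← Real.exp_sum, EuclideanSpace.real_norm_sq_eq, Finset.sum_div]
  rw [h2]
  refine Finset.prod_le_prod (fun q _ => integral_nonneg fun b => (Real.exp_pos _).le)
    fun q _ => integral_exp_bernoulli_le _ _

/-- Read from right to left, this linearizes the exponential of a square at the price of an
auxiliary Gaussian. -/
theorem integral_exp_mul_gaussianReal (x : ℝ) :
    ∫ g, Real.exp (√2 * x * g) ∂(gaussianReal 0 1) = Real.exp (x ^ 2) := by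
  have h := mgf_gaussianReal (p := gaussianReal 0 1) (X := id) (μ := 0) (v := 1)
    (by simp) (√2 * x)
  rw [mgf] at h
  simp only [id] at h
  rw [h]
  congr 1
  rw [mul_pow, Real.sq_sqrt (by norm_num)]
  simp

theorem integral_exp_sq_gaussianReal :
    ∫ g, Real.exp (g ^ 2 / 4) ∂(gaussianReal 0 1) = √2 := by
  rw [integral_gaussianReal_eq_integral_smul (by norm_num)]
  have : ∀ g : ℝ, gaussianPDFReal 0 1 g • Real.exp (g ^ 2 / 4) =
      (√(2 * Real.pi))⁻¹ * Real.exp (-(1 / 4) * g ^ 2) := by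
    intro g
    rw [gaussianPDFReal]
    simp only [smul_eq_mul, mul_assoc, ← Real.exp_add]
    congr 2
    · simp
    · simp; ring
  simp_rw [this]
  rw [integral_const_mul, integral_gaussian, ← Real.sqrt_inv, ← Real.sqrt_mul (by positivity)]
  congr 1
  field_simp
  norm_num

/-- Each squared coordinate of the projection is linearized by an independent Gaussian `g i`. After
the integrals are exchanged, the noise enters linearly and Hoeffding's bound applies; what remains
is one factor `E exp (g² / 4) = √2` per dimension. -/
theorem integral_exp_norm_sq_proj_noise_le (p : ι → I) (S : Submodule ℝ (EuclideanSpace ℝ ι)) :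
    ∫ a, Real.exp (‖S.orthogonalProjectionOnto (noise p a)‖ ^ 2) ∂(bernoulliPi p) ≤
      √2 ^ Module.finrank ℝ S := by
  classical
  let b := stdOrthonormalBasis ℝ S
  let γ : Measure (Fin (Module.finrank ℝ S) → ℝ) := Measure.pi fun _ => gaussianReal 0 1
  let F : (ι → Bool) → (Fin (Module.finrank ℝ S) → ℝ) → ℝ := fun a g =>
    ∏ i, Real.exp (√2 * inner ℝ (b i : EuclideanSpace ℝ ι) (noise p a) * g i)
  have hF : ∀ a, Real.exp (‖S.orthogonalProjectionOnto (noise p a)‖ ^ 2) = ∫ g, F a g ∂γ := by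
    intro a
    rw [integral_fintype_prod_eq_prod
      (f := fun i (x : ℝ) => Real.exp (√2 * inner ℝ (b i : EuclideanSpace ℝ ι) (noise p a) * x))]
    simp_rw [integral_exp_mul_gaussianReal]
    rw [← Real.exp_sum, ← b.sum_sq_norm_inner_right]
    congr 1
    refine Finset.sum_congr rfl fun i _ => ?_
    rw [Submodule.inner_orthogonalProjectionOnto_eq_of_mem_left, Real.norm_eq_abs, sq_abs]
  have hint : ∀ a, Integrable (F a) γ := by
    intro a
    refine Integrable.fintype_prod_dep
      (f := fun i (x : ℝ) => Real.exp (√2 * inner ℝ (b i : EuclideanSpace ℝ ι) (noise p a) * x))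
      fun i => ?_
    exact integrable_exp_mul_gaussianReal _
  have hswap : ∫ a, (∫ g, F a g ∂γ) ∂(bernoulliPi p) = ∫ g, (∫ a, F a g ∂(bernoulliPi p)) ∂γ := by
    simp_rw [integral_fintype (Integrable.of_finite (μ := bernoulliPi p))]
    rw [integral_finsetSum (f := fun a g => (bernoulliPi p).real {a} • F a g) _
      fun a _ => (hint a).const_mul _]
    exact Finset.sum_congr rfl fun a _ => (integral_smul _ _).symm
  simp_rw [hF]
  rw [hswap]
  -- A non-integrable function would have integral `0` by convention, but the integral is `√2`.
  have hq : Integrable (fun g : ℝ => Real.exp (g ^ 2 / 4)) (gaussianReal 0 1) := by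
    by_contra h
    have := integral_exp_sq_gaussianReal
    rw [integral_undef h] at this
    exact absurd this.symm (by positivity)
  have hle : ∀ g, ∫ a, F a g ∂(bernoulliPi p) ≤ ∏ i, Real.exp (g i ^ 2 / 4) := by
    intro g
    have h1 : ∀ a, F a g = Real.exp (inner ℝ ((∑ i, (√2 * g i) • b i : S) : EuclideanSpace ℝ ι)
        (noise p a)) := by
      intro a
      simp only [F]
      rw [← Real.exp_sum, Submodule.coe_sum, sum_inner]
      congr 1
      refine Finset.sum_congr rfl fun i _ => ?_
      rw [Submodule.coe_smul, real_inner_smul_left]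
      ring
    simp_rw [h1]
    refine (integral_exp_inner_noise_le p _).trans (le_of_eq ?_)
    rw [← Real.exp_sum, ← Submodule.coe_norm, ← real_inner_self_eq_norm_sq, b.orthonormal.inner_sum,
      Finset.sum_div]
    congr 1
    refine Finset.sum_congr rfl fun i _ => ?_
    simp only [conj_trivial]
    linear_combination g i ^ 2 / 8 * Real.sq_sqrt (show (0 : ℝ) ≤ 2 by norm_num)
  calc ∫ g, (∫ a, F a g ∂(bernoulliPi p)) ∂γ
      ≤ ∫ g, ∏ i, Real.exp (g i ^ 2 / 4) ∂γ := by
        refine integral_mono_of_nonneg (Filter.Eventually.of_forall fun g => ?_) ?_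
          (Filter.Eventually.of_forall hle)
        · exact integral_nonneg fun a => Finset.prod_nonneg fun i _ => (Real.exp_pos _).le
        · exact Integrable.fintype_prod_dep (f := fun i (x : ℝ) => Real.exp (x ^ 2 / 4))
            fun i => hq
    _ = √2 ^ Module.finrank ℝ S := by
        rw [integral_fintype_prod_eq_prod (f := fun i (x : ℝ) => Real.exp (x ^ 2 / 4))]
        simp [integral_exp_sq_gaussianReal]

/-- The noise pairs with the elements of `S` only through its projection to `S`. -/
theorem inner_noise_le_of_mem (p : ι → I) (a : ι → Bool) {S : Submodule ℝ (EuclideanSpace ℝ ι)}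
    {w : EuclideanSpace ℝ ι} (hw : w ∈ S) :
    2 * inner ℝ w (noise p a) ≤
      2 * ‖S.orthogonalProjectionOnto (noise p a)‖ ^ 2 + ‖w‖ ^ 2 / 2 := by
  have h1 := S.inner_orthogonalProjectionOnto_eq_of_mem_left ⟨w, hw⟩ (noise p a)
  have h2 := real_inner_le_norm (⟨w, hw⟩ : S) (S.orthogonalProjectionOnto (noise p a))
  rw [Submodule.coe_inner] at h2
  simp only [Submodule.coe_inner] at h1
  have h3 : ‖(⟨w, hw⟩ : S)‖ = ‖w‖ := rfl
  rw [h3] at h2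
  nlinarith [sq_nonneg (‖w‖ - 2 * ‖S.orthogonalProjectionOnto (noise p a)‖)]

/-- The mean is in fact zero; this cruder bound follows from the exponential moment by `1 + x ≤ exp
x` and costs only a constant in the oracle inequality. -/
theorem integral_inner_noise_le (p : ι → I) (w : EuclideanSpace ℝ ι) :
    ∫ a, inner ℝ w (noise p a) ∂(bernoulliPi p) ≤ ‖w‖ ^ 2 / 8 := by
  have h1 := integral_exp_inner_noise_le p w
  have h2 : ∀ a, inner ℝ w (noise p a) ≤
      ‖w‖ ^ 2 / 8 + (Real.exp (-(‖w‖ ^ 2 / 8)) * Real.exp (inner ℝ w (noise p a)) - 1) := by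
    intro a
    rw [← Real.exp_add]
    linarith [Real.add_one_le_exp (-(‖w‖ ^ 2 / 8) + inner ℝ w (noise p a))]
  refine (integral_mono Integrable.of_finite Integrable.of_finite h2).trans ?_
  rw [integral_add (integrable_const _) Integrable.of_finite,
    integral_sub Integrable.of_finite (integrable_const _), integral_const_mul]
  have h3 := mul_le_mul_of_nonneg_left h1 (Real.exp_pos (-(‖w‖ ^ 2 / 8))).le
  rw [← Real.exp_add, neg_add_cancel, Real.exp_zero] at h3
  simp
  linarith

end BernoulliNoise

/-! ### Frobenius norm and orthogonal invariance -/

section Frobenius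

variable {α β : Type}

/-- A matrix as a vector of its entries. -/
noncomputable def vec (B : Matrix α β ℝ) : EuclideanSpace ℝ (α × β) :=
  WithLp.toLp 2 fun q => B q.1 q.2

theorem vec_sub (B B' : Matrix α β ℝ) : vec (B - B') = vec B - vec B' := rfl

variable [Fintype α] [Fintype β]

theorem norm_vec_sq (B : Matrix α β ℝ) : ‖vec B‖ ^ 2 = frobSq B := by
  rw [EuclideanSpace.real_norm_sq_eq, frobSq, Fintype.sum_prod_type]
  rfl

theorem frobSq_eq_trace (B : Matrix α β ℝ) : frobSq B = (B * B.transpose).trace := by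
  simp [frobSq, Matrix.trace, Matrix.mul_apply, sq]

theorem frobSq_mul_orthogonal [DecidableEq β] (B : Matrix α β ℝ) {H : Matrix β β ℝ}
    (hH : H ∈ Matrix.orthogonalGroup β ℝ) : frobSq (B * H) = frobSq B := by
  have h := (Matrix.mem_orthogonalGroup_iff β ℝ).1 hH
  rw [frobSq_eq_trace, frobSq_eq_trace, Matrix.transpose_mul, Matrix.mul_assoc,
    ← Matrix.mul_assoc H, h, Matrix.one_mul]

end Frobenius

/-! ### Oracle inequality for fixed latent positions -/

variable {n L : ℕ}

/-- The matrix of success probabilities, given the latent positions. -/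
noncomputable def probMatrix (L : ℕ) (f : I → I → I → I) (ζ : Fin n → I) :
    Matrix (NodePair n) (Fin L) ℝ :=
  Matrix.of fun p l => (f (ζ p.1.1) (ζ p.1.2) (timePoint l) : ℝ)

theorem tensorNormSq_pack_sub_trueTensor (Θ : Matrix (NodePair n) (Fin L) ℝ) {f : I → I → I → I}
    (hf : ∀ x y t, f x y t = f y x t) (ζ : Fin n → I) :
    tensorNormSq (pack Θ - trueTensor L f ζ) = 2 * frobSq (Θ - probMatrix L f ζ) := by
  have hsub : ∀ g : Fin n × Fin n → ℝ,
      ∑ p : NodePair n, g p.1 = ∑ i, ∑ j, if i < j then g (i, j) else 0 := by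
    intro g
    rw [← Fintype.sum_prod_type' (f := fun i j => if i < j then g (i, j) else 0),
      ← Finset.sum_filter]
    exact (Finset.sum_subtype _ (by simp) _).symm
  let g : Fin n × Fin n → ℝ := fun p => ∑ l, (if h : p.1 < p.2 then
      (Θ ⟨p, h⟩ l - probMatrix L f ζ ⟨p, h⟩ l) ^ 2 else 0)
  have h1 : frobSq (Θ - probMatrix L f ζ) = ∑ p : NodePair n, g p.1 := by
    refine Finset.sum_congr rfl fun p _ => Finset.sum_congr rfl fun l _ => ?_
    rw [dif_pos p.2]
    rfl
  have h2 : ∀ i j, ∑ l, (pack Θ - trueTensor L f ζ) i j l ^ 2 =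
      (if i < j then g (i, j) else 0) + (if j < i then g (j, i) else 0) := by
    intro i j
    rcases lt_trichotomy i j with h | h | h
    · simp [g, h, h.not_gt, pack, trueTensor, probMatrix, h.ne]
    · simp [h, pack, trueTensor]
    · simp [g, h, h.not_gt, pack, trueTensor, probMatrix, h.ne', hf (ζ i)]
  rw [h1, hsub, tensorNormSq]
  simp_rw [h2, Finset.sum_add_distrib]
  rw [two_mul, Finset.sum_comm (f := fun i j => if j < i then g (j, i) else 0)]

/-- The matrix `Θ = Z V H` of a candidate. -/
noncomputable def Candidate.theta (H : Matrix (Fin L) (Fin L) ℝ) (c : Candidate n L) :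
    Matrix (NodePair n) (Fin L) ℝ :=
  clusterMatrix c.z * c.V * H

/-- The penalty of a candidate. -/
noncomputable def Candidate.penalty (c : Candidate n L) : ℝ :=
  11 * n * Real.log c.m
    + 11 / 2 * (c.m : ℝ) ^ 2 * (L : ℝ) ^ c.ρ * Real.log (25 * (L : ℝ) ^ (1 - c.ρ))

theorem objective_eq {H : Matrix (Fin L) (Fin L) ℝ} (hH : H ∈ Matrix.orthogonalGroup (Fin L) ℝ)
    (a : Obs n L) (c : Candidate n L) :
    objective H a c = frobSq (dataMatrix a - c.theta H) + c.penalty := by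
  have h := (Matrix.mem_orthogonalGroup_iff' (Fin L) ℝ).1 hH
  rw [objective, Candidate.penalty, ← add_assoc, ← frobSq_mul_orthogonal _ hH, Matrix.sub_mul,
    Matrix.mul_assoc (dataMatrix a), h, Matrix.mul_one, Candidate.theta]

/-- The span of `θ` and the vectors of the matrices `Z V H`, where only the first `k` columns of `V`
are nonzero. -/
noncomputable def clusterSpace (H : Matrix (Fin L) (Fin L) ℝ)
    (θ : EuclideanSpace ℝ (NodePair n × Fin L)) {m : ℕ} (z : Fin n → Fin m) (k : ℕ) :
    Submodule ℝ (EuclideanSpace ℝ (NodePair n × Fin L)) :=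
  Submodule.span ℝ (Set.range fun o : Option (Sym2 (Fin m) × {l : Fin L // (l : ℕ) < k}) =>
    o.elim θ fun s => vec (Matrix.of fun p l => clusterMatrix z p s.1 * H s.2.1 l))

theorem card_sym2_fin_le (m : ℕ) : Fintype.card (Sym2 (Fin m)) ≤ m ^ 2 := by
  refine (Fintype.card_le_of_surjective (fun x : Fin m × Fin m => s(x.1, x.2)) ?_).trans
    (by simp [sq])
  exact Sym2.ind fun x y => ⟨(x, y), rfl⟩

theorem finrank_clusterSpace_le (H : Matrix (Fin L) (Fin L) ℝ)
    (θ : EuclideanSpace ℝ (NodePair n × Fin L)) {m : ℕ} (z : Fin n → Fin m) (k : ℕ) :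
    Module.finrank ℝ (clusterSpace H θ z k) ≤ m ^ 2 * k + 1 := by
  refine (finrank_range_le_card _).trans ?_
  rw [Fintype.card_option, Fintype.card_prod]
  have h : Fintype.card {l : Fin L // (l : ℕ) < k} ≤ k := by
    simpa using Fintype.card_le_of_injective
      (fun l : {l : Fin L // (l : ℕ) < k} => (⟨l.1, l.2⟩ : Fin k))
      fun l l' h => Subtype.ext (Fin.ext (by simpa using h))
  gcongr
  exact card_sym2_fin_le m

/-- The space depends on the candidate only through `z` and `k`, not on the data-dependent `V`, so
finitely many spaces cover all possible errors. The extra generator `θ` costs one dimension. -/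
theorem mem_clusterSpace (H : Matrix (Fin L) (Fin L) ℝ)
    (θ : EuclideanSpace ℝ (NodePair n × Fin L)) (c : Candidate n L) {k : ℕ}
    (hk : (L : ℝ) ^ c.ρ = k) : vec (c.theta H) - θ ∈ clusterSpace H θ c.z k := by
  refine Submodule.sub_mem _ ?_ (Submodule.subset_span ⟨none, rfl⟩)
  have h : vec (c.theta H) = ∑ s, ∑ l : {l : Fin L // (l : ℕ) < k},
      c.V s l • vec (Matrix.of fun p l' => clusterMatrix c.z p s * H l l') := by
    ext ⟨p, l'⟩
    simp only [vec, Candidate.theta, WithLp.ofLp_sum, WithLp.ofLp_smul, Finset.sum_apply,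
      Pi.smul_apply, Matrix.of_apply, smul_eq_mul, Matrix.mul_apply, Finset.sum_mul]
    rw [Finset.sum_comm]
    refine Finset.sum_congr rfl fun s _ => ?_
    rw [← Finset.sum_subset (Finset.subset_univ {l : Fin L | (l : ℕ) < k}) fun l _ hl => ?_]
    · rw [Finset.sum_subtype (p := fun l : Fin L => (l : ℕ) < k) _ (by simp)]
      exact Finset.sum_congr rfl fun l _ => by ring
    · rw [c.V_eq_zero s l (by rw [hk]; exact_mod_cast not_lt.1 (by simpa using hl))]
      ring
  rw [h]
  exact Submodule.sum_mem _ fun s _ => Submodule.sum_mem _ fun l _ =>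
    Submodule.smul_mem _ _ (Submodule.subset_span ⟨some (s, l), rfl⟩)

/-- The subtracted term makes the induction close, because `e ≥ 2`. -/
theorem sum_exp_neg_le (n : ℕ) :
    ∑ m ∈ Finset.Icc 1 n, Real.exp (-(m : ℝ)) ≤ 1 - Real.exp (-(n : ℝ)) := by
  induction n with
  | zero => simp
  | succ n ih =>
    rw [Finset.sum_Icc_succ_top (by omega)]
    have h : Real.exp (-(n : ℝ)) = Real.exp 1 * Real.exp (-((n + 1 : ℕ) : ℝ)) := by
      rw [← Real.exp_add]; push_cast; ring_nf
    have := Real.add_one_le_exp 1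
    nlinarith [Real.exp_pos (-((n + 1 : ℕ) : ℝ))]

/-- The exponential moments of the noise in all cluster spaces, damped by the penalty. -/
noncomputable def excess (H : Matrix (Fin L) (Fin L) ℝ) (f : I → I → I → I) (ζ : Fin n → I)
    (a : Obs n L) : ℝ :=
  ∑ m ∈ Finset.Icc 1 n, ∑ k ∈ Finset.Icc 1 L, ∑ z : Fin n → Fin m,
    Real.exp (-(11 / 2 * n * Real.log m + 8 * (m ^ 2 * k))) *
      Real.exp (‖(clusterSpace H (vec (probMatrix L f ζ)) z k).orthogonalProjectionOnto
        (noise (fun q => f (ζ q.1.1.1) (ζ q.1.1.2) (timePoint q.2)) a)‖ ^ 2)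

theorem integral_excess_le (H : Matrix (Fin L) (Fin L) ℝ) (f : I → I → I → I) (ζ : Fin n → I) :
    ∫ a, excess H f ζ a ∂(obsLaw L f ζ) ≤ 1 := by
  have hμ : obsLaw L f ζ =
    bernoulliPi fun q => f (ζ q.1.1.1) (ζ q.1.1.2) (timePoint q.2) := rfl
  rw [hμ]
  unfold excess
  rw [integral_finsetSum _ fun _ _ => Integrable.of_finite]
  have hterm : ∀ m ∈ Finset.Icc 1 n, ∀ k ∈ Finset.Icc 1 L, ∑ z : Fin n → Fin m,
      Real.exp (-(11 / 2 * n * Real.log m + 8 * (m ^ 2 * k))) *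
        √2 ^ Module.finrank ℝ (clusterSpace H (vec (probMatrix L f ζ)) z k) ≤
      Real.exp (-(m : ℝ)) * Real.exp (-(k : ℝ)) := by
    intro m hm k hk
    have hm1 : (1 : ℝ) ≤ m := by exact_mod_cast (Finset.mem_Icc.1 hm).1
    have hk1 : (1 : ℝ) ≤ k := by exact_mod_cast (Finset.mem_Icc.1 hk).1
    have hsqrt : √2 ≤ Real.exp (1 / 2) := by
      rw [Real.sqrt_le_iff]
      refine ⟨(Real.exp_pos _).le, ?_⟩
      rw [← Real.exp_nat_mul]
      have := Real.add_one_le_exp (1 : ℝ)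
      norm_num at this ⊢
      linarith
    have hz : ∀ z : Fin n → Fin m,
        √2 ^ Module.finrank ℝ (clusterSpace H (vec (probMatrix L f ζ)) z k) ≤
          Real.exp ((m ^ 2 * k + 1) / 2) := by
      intro z
      calc √2 ^ Module.finrank ℝ (clusterSpace H (vec (probMatrix L f ζ)) z k)
          ≤ √2 ^ (m ^ 2 * k + 1) :=
            pow_le_pow_right₀ (by rw [Real.one_le_sqrt]; norm_num) (finrank_clusterSpace_le H _ z k)
        _ ≤ Real.exp (1 / 2) ^ (m ^ 2 * k + 1) := by gcongr
        _ = Real.exp ((m ^ 2 * k + 1) / 2) := by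
            rw [← Real.exp_nat_mul]; push_cast; ring_nf
    -- The entropy of the labelings, which the `n * log m` part of the damping absorbs.
    have hcard : (Fintype.card (Fin n → Fin m) : ℝ) = Real.exp (n * Real.log m) := by
      rw [Real.exp_nat_mul, Real.exp_log (by linarith)]
      simp
    calc _ ≤ ∑ z : Fin n → Fin m, Real.exp (-(11 / 2 * n * Real.log m + 8 * (m ^ 2 * k))) *
          Real.exp ((m ^ 2 * k + 1) / 2) :=
          Finset.sum_le_sum fun z _ => mul_le_mul_of_nonneg_left (hz z) (Real.exp_pos _).le
      _ = Real.exp (n * Real.log m + (-(11 / 2 * n * Real.log m + 8 * (m ^ 2 * k)) +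
          (m ^ 2 * k + 1) / 2)) := by
          rw [Finset.sum_const, Finset.card_univ, nsmul_eq_mul, hcard, ← Real.exp_add,
            ← Real.exp_add]
      _ ≤ Real.exp (-(m : ℝ)) * Real.exp (-(k : ℝ)) := by
          rw [← Real.exp_add, Real.exp_le_exp]
          have hlog : 0 ≤ n * Real.log m := mul_nonneg n.cast_nonneg (Real.log_nonneg hm1)
          have h1 : (m : ℝ) ≤ m ^ 2 * k := by
            nlinarith [mul_nonneg (sub_nonneg.2 hm1) (sub_nonneg.2 hk1)]
          have h2 : (k : ℝ) ≤ m ^ 2 * k := by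
            nlinarith [one_le_pow₀ hm1 (n := 2)]
          linarith
  calc _ ≤ ∑ m ∈ Finset.Icc 1 n, ∑ k ∈ Finset.Icc 1 L,
        Real.exp (-(m : ℝ)) * Real.exp (-(k : ℝ)) := by
        refine Finset.sum_le_sum fun m hm => ?_
        rw [integral_finsetSum _ fun _ _ => Integrable.of_finite]
        refine Finset.sum_le_sum fun k hk => ?_
        rw [integral_finsetSum _ fun _ _ => Integrable.of_finite]
        refine le_trans (Finset.sum_le_sum fun z _ => ?_) (hterm m hm k hk)
        rw [integral_const_mul]
        exact mul_le_mul_of_nonneg_left (integral_exp_norm_sq_proj_noise_le _ _) (Real.exp_pos _).le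
    _ = (∑ m ∈ Finset.Icc 1 n, Real.exp (-(m : ℝ))) * ∑ k ∈ Finset.Icc 1 L, Real.exp (-(k : ℝ)) := by
        rw [Finset.sum_mul_sum]
    _ ≤ 1 := by
        have h1 := sum_exp_neg_le n
        have h2 := sum_exp_neg_le L
        refine mul_le_one₀ ?_ (Finset.sum_nonneg fun _ _ => (Real.exp_pos _).le) ?_
        · linarith [Real.exp_pos (-(n : ℝ))]
        · linarith [Real.exp_pos (-(L : ℝ))]

theorem Candidate.exists_rank (c : Candidate n L) (hL : 1 ≤ L) :
    ∃ k : ℕ, (L : ℝ) ^ c.ρ = k ∧ 1 ≤ k ∧ k ≤ L := by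
  obtain ⟨h0, h1, k, hk⟩ := c.rho_mem
  have hL' : (1 : ℝ) ≤ L := by exact_mod_cast hL
  refine ⟨k, hk, ?_, ?_⟩
  · have := Real.one_le_rpow hL' h0.le
    rw [hk] at this
    exact_mod_cast this
  · have := Real.rpow_le_rpow_of_exponent_le hL' h1
    rw [hk, Real.rpow_one] at this
    exact_mod_cast this

theorem three_le_log : 3 ≤ Real.log 25 := by
  rw [Real.le_log_iff_exp_le (by norm_num)]
  have h := Real.exp_one_lt_d9
  have h2 : Real.exp 3 = Real.exp 1 ^ 3 := by rw [← Real.exp_nat_mul]; norm_num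
  rw [h2]
  calc Real.exp 1 ^ 3 ≤ 2.72 ^ 3 := by gcongr; linarith
    _ ≤ 25 := by norm_num

/-- The constant `25` ensures that the logarithm is at least `3`, and `3 · 11 / 2 ≥ 16`. Half of the
lower bound is the damping exponent in `excess`. -/
theorem Candidate.le_penalty (c : Candidate n L) (hL : 1 ≤ L) {k : ℕ} (hk : (L : ℝ) ^ c.ρ = k) :
    11 * n * Real.log c.m + 16 * ((c.m : ℝ) ^ 2 * k) ≤ c.penalty := by
  have hL' : (1 : ℝ) ≤ L := by exact_mod_cast hL
  have h1 : 3 ≤ Real.log (25 * (L : ℝ) ^ (1 - c.ρ)) := by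
    refine three_le_log.trans (Real.log_le_log (by norm_num) ?_)
    have := Real.one_le_rpow hL' (sub_nonneg.2 c.rho_mem.2.1)
    linarith
  rw [Candidate.penalty, hk]
  have h2 : 0 ≤ (c.m : ℝ) ^ 2 * k := by positivity
  nlinarith

theorem frobSq_le_excess {H : Matrix (Fin L) (Fin L) ℝ} (hH : H ∈ Matrix.orthogonalGroup (Fin L) ℝ)
    (hL : 1 ≤ L) (f : I → I → I → I) (ζ : Fin n → I) (a : Obs n L) {c c₀ : Candidate n L}
    (hc : objective H a c ≤ objective H a c₀) :
    frobSq (c.theta H - probMatrix L f ζ) ≤ 2 * frobSq (c₀.theta H - probMatrix L f ζ) +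
      2 * c₀.penalty + 4 * inner ℝ (-vec (c₀.theta H - probMatrix L f ζ))
        (noise (fun q => f (ζ q.1.1.1) (ζ q.1.1.2) (timePoint q.2)) a) + 4 * excess H f ζ a := by
  obtain ⟨k, hk, hk1, hkL⟩ := c.exists_rank hL
  set p : NodePair n × Fin L → I := fun q => f (ζ q.1.1.1) (ζ q.1.1.2) (timePoint q.2) with hp
  set ξ := noise p a with hξ
  have hdata : ∀ Θ, frobSq (dataMatrix a - Θ) = ‖ξ - vec (Θ - probMatrix L f ζ)‖ ^ 2 := by
    intro Θ
    rw [← norm_vec_sq]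
    congr 2
    ext q
    simp [vec, dataMatrix, hξ, noise, probMatrix, hp]
  rw [objective_eq hH, objective_eq hH, hdata, hdata, norm_sub_sq_real, norm_sub_sq_real,
    norm_vec_sq, norm_vec_sq] at hc
  -- The estimator's error absorbs the `‖w‖ ^ 2 / 2` produced here, which is why the final bound
  -- carries a factor `2`.
  have h1 := inner_noise_le_of_mem p a (mem_clusterSpace H (vec (probMatrix L f ζ)) c hk)
  rw [← vec_sub, norm_vec_sq] at h1
  have h2 := c.le_penalty hL hk
  set q := ‖(clusterSpace H (vec (probMatrix L f ζ)) c.z k).orthogonalProjectionOnto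
    (noise p a)‖ ^ 2 with hq
  have h3 : Real.exp (-(11 / 2 * n * Real.log c.m + 8 * (c.m ^ 2 * k))) * Real.exp q ≤
      excess H f ζ a := by
    have e1 := Finset.single_le_sum (s := Finset.Icc 1 n) (f := fun m : ℕ =>
      ∑ k ∈ Finset.Icc 1 L, ∑ z : Fin n → Fin m,
        Real.exp (-(11 / 2 * n * Real.log m + 8 * (m ^ 2 * k))) *
        Real.exp (‖(clusterSpace H (vec (probMatrix L f ζ)) z k).orthogonalProjectionOnto
        (noise p a)‖ ^ 2)) (fun _ _ => by positivity) (Finset.mem_Icc.2 ⟨c.one_le_m, c.m_le_n⟩)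
    have e2 := Finset.single_le_sum (s := Finset.Icc 1 L) (f := fun k : ℕ =>
      ∑ z : Fin n → Fin c.m,
        Real.exp (-(11 / 2 * n * Real.log c.m + 8 * (c.m ^ 2 * k))) *
        Real.exp (‖(clusterSpace H (vec (probMatrix L f ζ)) z k).orthogonalProjectionOnto
        (noise p a)‖ ^ 2)) (fun _ _ => by positivity) (Finset.mem_Icc.2 ⟨hk1, hkL⟩)
    have e3 := Finset.single_le_sum (s := Finset.univ) (f := fun z : Fin n → Fin c.m =>
        Real.exp (-(11 / 2 * n * Real.log c.m + 8 * (c.m ^ 2 * k))) *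
        Real.exp (‖(clusterSpace H (vec (probMatrix L f ζ)) z k).orthogonalProjectionOnto
        (noise p a)‖ ^ 2)) (fun _ _ => by positivity) (Finset.mem_univ c.z)
    exact e3.trans (e2.trans e1)
  rw [← Real.exp_add] at h3
  -- Bounds the projected noise minus half the penalty by a single summand of `excess`, without a
  -- tail integral.
  have h4 := Real.add_one_le_exp (-(11 / 2 * n * Real.log c.m + 8 * (c.m ^ 2 * k)) + q)
  rw [← hξ, real_inner_comm] at h1
  rw [inner_neg_left, real_inner_comm]
  linarith

/-- The oracle inequality for the penalized least squares estimator, given the positions. -/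
theorem integral_tensorNormSq_le {H : Matrix (Fin L) (Fin L) ℝ}
    (hH : H ∈ Matrix.orthogonalGroup (Fin L) ℝ) (hL : 1 ≤ L) {f : I → I → I → I}
    (hf : ∀ x y t, f x y t = f y x t) (ζ : Fin n → I) {est : Obs n L → Tensor n L}
    (hest : IsEstimator H est) (c₀ : Candidate n L) :
    ∫ a, tensorNormSq (est a - trueTensor L f ζ) ∂(obsLaw L f ζ) ≤
      6 * frobSq (c₀.theta H - probMatrix L f ζ) + 4 * c₀.penalty + 8 := by
  have hμ : obsLaw L f ζ =
    bernoulliPi fun q => f (ζ q.1.1.1) (ζ q.1.1.2) (timePoint q.2) := rfl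
  have hpt : ∀ a, tensorNormSq (est a - trueTensor L f ζ) ≤
      (4 * frobSq (c₀.theta H - probMatrix L f ζ) + 4 * c₀.penalty) +
      (8 * inner ℝ (-vec (c₀.theta H - probMatrix L f ζ))
        (noise (fun q => f (ζ q.1.1.1) (ζ q.1.1.2) (timePoint q.2)) a) +
      8 * excess H f ζ a) := by
    intro a
    obtain ⟨c, hc, he⟩ := hest a
    have := frobSq_le_excess hH hL f ζ a (hc c₀)
    rw [he, Candidate.tensor, tensorNormSq_pack_sub_trueTensor _ hf, ← Candidate.theta]
    linarith
  have hex := integral_excess_le H f ζ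
  have hin := integral_inner_noise_le (fun q : NodePair n × Fin L =>
    f (ζ q.1.1.1) (ζ q.1.1.2) (timePoint q.2)) (-vec (c₀.theta H - probMatrix L f ζ))
  rw [norm_neg, norm_vec_sq] at hin
  rw [hμ] at hex ⊢
  refine (integral_mono Integrable.of_finite Integrable.of_finite hpt).trans ?_
  rw [integral_add (integrable_const _) Integrable.of_finite, integral_const,
    integral_add Integrable.of_finite Integrable.of_finite, integral_const_mul, integral_const_mul]
  have hpos : 0 ≤ frobSq (c₀.theta H - probMatrix L f ζ) := by rw [← norm_vec_sq]; positivity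
  simp only [probReal_univ, one_smul]
  linarith

/-! ### Approximation of graphons by candidates -/

/-- Rounding a real exponent to an admissible one changes `L ^ ρ` by a factor of at most `2`. The
last clause keeps the truncation error zero at `ρ = 1`. -/
theorem exists_mem_rhoSet (hL : 1 ≤ L) {ρ : ℝ} (h0 : 0 ≤ ρ) (h1 : ρ ≤ 1) :
    ∃ ρ' ∈ rhoSet L, ∃ k : ℕ, (L : ℝ) ^ ρ' = k ∧ (L : ℝ) ^ ρ ≤ k ∧ (k : ℝ) ≤ 2 * (L : ℝ) ^ ρ ∧
      k ≤ L ∧ (ρ = 1 → k = L) := by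
  have hL' : (1 : ℝ) ≤ L := by exact_mod_cast hL
  have hone := Real.one_le_rpow hL' h0
  have hle : (L : ℝ) ^ ρ ≤ L := by
    simpa using Real.rpow_le_rpow_of_exponent_le hL' h1
  rcases hL.eq_or_lt with rfl | hL2
  · exact ⟨1, ⟨one_pos, le_rfl, 1, by simp⟩, 1, by simp⟩
  · have hL2' : (1 : ℝ) < L := by exact_mod_cast hL2
    -- The value `k = 1` is excluded because it would force the exponent `0`, which is not
    -- admissible.
    set k := max 2 ⌈(L : ℝ) ^ ρ⌉₊ with hk
    have hk2 : (2 : ℝ) ≤ k := by exact_mod_cast le_max_left _ _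
    have hkL : k ≤ L := max_le hL2 (Nat.ceil_le.2 hle)
    have hkL' : (k : ℝ) ≤ L := by exact_mod_cast hkL
    have hlogL := Real.log_pos hL2'
    have hpow : (L : ℝ) ^ (Real.log k / Real.log L) = k := by
      rw [Real.rpow_def_of_pos (by linarith), mul_div_cancel₀ _ hlogL.ne', Real.exp_log (by linarith)]
    have hceil : (L : ℝ) ^ ρ ≤ k := (Nat.le_ceil _).trans (by exact_mod_cast le_max_right _ _)
    refine ⟨Real.log k / Real.log L, ⟨div_pos (Real.log_pos (by linarith)) hlogL,
      (div_le_one hlogL).2 (Real.log_le_log (by linarith) hkL'), k, hpow⟩, k, hpow, hceil, ?_, hkL, ?_⟩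
    · rw [hk, Nat.cast_max]
      refine max_le (by push_cast; linarith) ?_
      linarith [Nat.ceil_lt_add_one (show 0 ≤ (L : ℝ) ^ ρ by linarith)]
    · rintro rfl
      rw [Real.rpow_one] at hceil
      exact le_antisymm hkL (by exact_mod_cast hceil)

section Pieces

variable {r : ℕ} {β : Fin (r + 1) → ℝ}

theorem exists_mem_piece (h1 : β (Fin.last r) = 1) (hr : 0 < r) (x : I) : ∃ i, x ∈ piece β i := by
  classical
  have hex : ∃ j : ℕ, ∃ hj : j < r, (x : ℝ) ≤ β (Fin.succ ⟨j, hj⟩) := by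
    refine ⟨r - 1, by omega, ?_⟩
    have : Fin.succ (⟨r - 1, by omega⟩ : Fin r) = Fin.last r := by
      ext; simp; omega
    rw [this, h1]
    exact x.2.2
  obtain ⟨hj, hx⟩ := Nat.find_spec hex
  refine ⟨⟨Nat.find hex, hj⟩, ?_, hx⟩
  by_contra hcon
  push Not at hcon
  obtain ⟨hne, hle⟩ := hcon
  -- The left end of the first piece that reaches `x` is the right end of its predecessor.
  refine Nat.find_min hex (Nat.sub_one_lt hne) ⟨by omega, hle.trans_eq ?_⟩
  congr 1
  ext
  simp only [Fin.val_castSucc, Fin.val_succ]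
  simp only at hne
  omega

theorem piece_mono (hβ : StrictMono β) {x y : I} (hxy : x ≤ y) {i j : Fin r} (hx : x ∈ piece β i)
    (hy : y ∈ piece β j) : i ≤ j := by
  by_contra h
  rw [not_le] at h
  rcases hx.1 with h0 | h0
  · rw [Fin.lt_def] at h; omega
  · have : β j.succ ≤ β i.castSucc := hβ.monotone (by
      rw [Fin.le_def]; simpa using h)
    have hxy' : (x : ℝ) ≤ y := hxy
    linarith [hy.2]

/-- Grid cells of width `1 / h` refined by the pieces give `h + r` classes. -/
theorem exists_clustering (hβ : StrictMono β) (h1 : β (Fin.last r) = 1) (hr : 0 < r) {h : ℕ}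
    (hh : 1 ≤ h) (ζ : Fin n → I) : ∃ (z : Fin n → Fin (h + r)) (q : I → Fin r),
      (∀ x, x ∈ piece β (q x)) ∧
      ∀ i j, z i = z j → q (ζ i) = q (ζ j) ∧ |(ζ i : ℝ) - ζ j| ≤ 1 / h := by
  choose q hq using exists_mem_piece h1 hr
  have hh' : (0 : ℝ) < h := by exact_mod_cast hh
  have hfl : ∀ x : I, ⌊(h : ℝ) * x⌋₊ ≤ h := fun x => by
    refine (Nat.floor_mono (mul_le_of_le_one_right hh'.le x.2.2)).trans (by simp)
  -- The label is the sum of the cell and piece indices. Both are monotone in `x`, so equal sums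
  -- force both to be equal; this gives `h + r` classes instead of a product.
  have hlt : ∀ x : I, ⌊(h : ℝ) * x⌋₊ + q x < h + r := fun x =>
    add_lt_add_of_le_of_lt (hfl x) (q x).2
  have key : ∀ x y : I, x ≤ y → ⌊(h : ℝ) * x⌋₊ + q x = ⌊(h : ℝ) * y⌋₊ + q y →
      q x = q y ∧ |(x : ℝ) - y| ≤ 1 / h := by
    intro x y hxy he
    have hxy' : (x : ℝ) ≤ y := hxy
    have e1 : (q x : ℕ) ≤ q y := piece_mono hβ hxy (hq x) (hq y)
    have e2 : ⌊(h : ℝ) * x⌋₊ ≤ ⌊(h : ℝ) * y⌋₊ := Nat.floor_mono (by gcongr)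
    refine ⟨Fin.ext (by omega), ?_⟩
    have e3 : (⌊(h : ℝ) * x⌋₊ : ℝ) = ⌊(h : ℝ) * y⌋₊ := by exact_mod_cast (by omega)
    have e4 := Nat.floor_le (mul_nonneg hh'.le x.2.1)
    have e5 := Nat.lt_floor_add_one ((h : ℝ) * y)
    rw [abs_sub_comm, abs_of_nonneg (by linarith), le_div_iff₀ hh']
    linarith
  refine ⟨fun i => ⟨_, hlt (ζ i)⟩, q, hq, fun i j hij => ?_⟩
  have hij' := Fin.mk.inj_iff.1 hij
  rcases le_total (ζ i) (ζ j) with hle | hle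
  · exact key _ _ hle hij'
  · have := key _ _ hle hij'.symm
    exact ⟨this.1.symm, abs_sub_comm (ζ j : ℝ) (ζ i) ▸ this.2⟩

end Pieces

theorem coeff_comm (H : Matrix (Fin L) (Fin L) ℝ) {f : I → I → I → I}
    (hf : ∀ x y t, f x y t = f y x t) (x y : I) : coeff H f x y = coeff H f y x := by
  simp only [coeff, hf x y]

/-- The coefficient vectors of a representative pair of every pair of classes, cut off after the
first `k` entries. -/
noncomputable def clusterCoeff (H : Matrix (Fin L) (Fin L) ℝ) (f : I → I → I → I) (ζ : Fin n → I)
    {m : ℕ} (z : Fin n → Fin m) (k : ℕ) : Matrix (Sym2 (Fin m)) (Fin L) ℝ := by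
  classical
  exact Matrix.of fun s l =>
    if h : (l : ℕ) < k ∧ ∃ p : NodePair n, s(z p.1.1, z p.1.2) = s then
      coeff H f (ζ h.2.choose.1.1) (ζ h.2.choose.1.2) l else 0

/-- Orthogonality of `H` moves the error to the coefficients, where the smoothness assumptions live.
-/
theorem frobSq_theta_sub_probMatrix {H : Matrix (Fin L) (Fin L) ℝ}
    (hH : H ∈ Matrix.orthogonalGroup (Fin L) ℝ) (f : I → I → I → I) (ζ : Fin n → I)
    (c : Candidate n L) : frobSq (c.theta H - probMatrix L f ζ) =
      ∑ p : NodePair n, ∑ l, (c.V s(c.z p.1.1, c.z p.1.2) l - coeff H f (ζ p.1.1) (ζ p.1.2) l) ^ 2 := by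
  have h := (Matrix.mem_orthogonalGroup_iff' (Fin L) ℝ).1 hH
  have h2 : c.theta H - probMatrix L f ζ =
      (clusterMatrix c.z * c.V - probMatrix L f ζ * H.transpose) * H := by
    rw [Matrix.sub_mul, Matrix.mul_assoc (probMatrix L f ζ), h, Matrix.mul_one, Candidate.theta]
  rw [h2, frobSq_mul_orthogonal _ hH, frobSq]
  refine Finset.sum_congr rfl fun p _ => Finset.sum_congr rfl fun l _ => ?_
  congr 1
  rw [Matrix.sub_apply]
  congr 1
  · simp [Matrix.mul_apply, clusterMatrix]
  · simp [Matrix.mul_apply, probMatrix, coeff, Matrix.mulVec, dotProduct, mul_comm]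

theorem card_nodePair_le (n : ℕ) : (Fintype.card (NodePair n) : ℝ) ≤ (n : ℝ) ^ 2 := by
  have : Fintype.card (NodePair n) ≤ n ^ 2 :=
    (Fintype.card_subtype_le _).trans (by simp [sq])
  exact_mod_cast this

theorem sum_clusterCoeff_le {H : Matrix (Fin L) (Fin L) ℝ} {f : I → I → I → I}
    (hf : ∀ x y t, f x y t = f y x t) {r : ℕ} {β : Fin (r + 1) → ℝ} {ν₁ ν₂ K₁ K₂ : ℝ}
    (hν₁ : 0 < ν₁) (hν₂ : 0 < ν₂) (hK₁ : 0 < K₁)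
    (hβ : ∀ i j : Fin r, ∀ x ∈ piece β i, ∀ x' ∈ piece β i, ∀ y ∈ piece β j, ∀ y' ∈ piece β j,
        (∀ l, (coeff H f x y l - coeff H f x' y' l) ^ 2 ≤
          K₁ * (|(x : ℝ) - x'| + |(y : ℝ) - y'|) ^ (2 * ν₁)) ∧
        ∑ l : Fin L, (l : ℝ) ^ (2 * ν₂) * coeff H f x y l ^ 2 ≤ K₂)
    {ζ : Fin n → I} {m : ℕ} {z : Fin n → Fin m} {q : I → Fin r} (hq : ∀ x, x ∈ piece β (q x)) {δ : ℝ}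
    (hz : ∀ i j, z i = z j → q (ζ i) = q (ζ j) ∧ |(ζ i : ℝ) - ζ j| ≤ δ) {k : ℕ} (hk : 1 ≤ k)
    (p : NodePair n) :
    ∑ l, (clusterCoeff H f ζ z k s(z p.1.1, z p.1.2) l - coeff H f (ζ p.1.1) (ζ p.1.2) l) ^ 2 ≤
      k * (K₁ * (2 * δ) ^ (2 * ν₁)) + (if k < L then 1 else 0) * (K₂ / (k : ℝ) ^ (2 * ν₂)) := by
  classical
  set D := K₁ * (2 * δ) ^ (2 * ν₁) with hD
  have hδ : 0 ≤ δ := (abs_nonneg _).trans (hz p.1.1 p.1.1 rfl).2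
  have hD0 : 0 ≤ D := by positivity
  have hk0 : (0 : ℝ) < k := by exact_mod_cast hk
  have hhead : ∀ l : Fin L, (l : ℕ) < k →
      (clusterCoeff H f ζ z k s(z p.1.1, z p.1.2) l - coeff H f (ζ p.1.1) (ζ p.1.2) l) ^ 2 ≤ D := by
    intro l hl
    have hex : (l : ℕ) < k ∧ ∃ p' : NodePair n, s(z p'.1.1, z p'.1.2) = s(z p.1.1, z p.1.2) :=
      ⟨hl, p, rfl⟩
    rw [clusterCoeff, Matrix.of_apply, dif_pos hex]
    have hspec := hex.2.choose_spec
    set p' := hex.2.choose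
    have hbound : ∀ i j, z p'.1.1 = z i → z p'.1.2 = z j →
        (coeff H f (ζ p'.1.1) (ζ p'.1.2) l - coeff H f (ζ i) (ζ j) l) ^ 2 ≤ D := by
      intro i j hi hj
      obtain ⟨a1, b1⟩ := hz _ _ hi
      obtain ⟨a2, b2⟩ := hz _ _ hj
      refine ((hβ (q (ζ i)) (q (ζ j)) _ (a1 ▸ hq _) _ (hq _) _ (a2 ▸ hq _) _ (hq _)).1 l).trans ?_
      rw [hD]
      gcongr
      linarith
    -- The representative may match the pair in swapped order; symmetry of `f` covers that case.
    rcases Sym2.eq_iff.1 hspec with ⟨e1, e2⟩ | ⟨e1, e2⟩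
    · exact hbound _ _ e1 e2
    · rw [coeff_comm H hf (ζ p.1.1)]
      exact hbound _ _ e1 e2
  -- Dropped indices satisfy `l ≥ k`, so the weight `(l / k) ^ (2 * ν₂)` is at least `1`; such an
  -- index exists only if `k < L`.
  have htail : ∀ l : Fin L, ¬ (l : ℕ) < k →
      (clusterCoeff H f ζ z k s(z p.1.1, z p.1.2) l - coeff H f (ζ p.1.1) (ζ p.1.2) l) ^ 2 ≤
        (if k < L then 1 else 0) *
        ((l : ℝ) ^ (2 * ν₂) * coeff H f (ζ p.1.1) (ζ p.1.2) l ^ 2 / (k : ℝ) ^ (2 * ν₂)) := by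
    intro l hl
    rw [clusterCoeff, Matrix.of_apply, dif_neg (fun h => hl h.1), if_pos (by omega), one_mul,
      zero_sub, neg_sq, le_div_iff₀ (by positivity), mul_comm]
    have hkl : (k : ℝ) ≤ l := by exact_mod_cast not_lt.1 hl
    gcongr
  have hcard : (Finset.univ.filter fun l : Fin L => (l : ℕ) < k).card ≤ k := by
    simpa using Finset.card_le_card_of_injOn (t := Finset.range k) (fun l : Fin L => (l : ℕ))
      (by intro l; simp) (fun a _ b _ h => Fin.ext h)
  rw [← Finset.sum_filter_add_sum_filter_not Finset.univ fun l : Fin L => (l : ℕ) < k]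
  refine add_le_add ?_ ?_
  · refine (Finset.sum_le_card_nsmul _ _ D fun l hl => hhead l (Finset.mem_filter.1 hl).2).trans ?_
    rw [nsmul_eq_mul]
    gcongr
  · refine (Finset.sum_le_sum fun l hl => htail l (Finset.mem_filter.1 hl).2).trans ?_
    rw [← Finset.mul_sum, ← Finset.sum_div]
    refine mul_le_mul_of_nonneg_left ?_ (by split_ifs <;> norm_num)
    gcongr
    refine le_trans (Finset.sum_le_sum_of_subset_of_nonneg (Finset.filter_subset _ _)
      fun l _ _ => by positivity) (hβ _ _ _ (hq (ζ p.1.1)) _ (hq (ζ p.1.1)) _ (hq (ζ p.1.2)) _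
        (hq (ζ p.1.2))).2

/-- Every graphon of the class is well approximated by a candidate with a small penalty. -/
theorem exists_candidate {H : Matrix (Fin L) (Fin L) ℝ} (hH : H ∈ Matrix.orthogonalGroup (Fin L) ℝ)
    (hL : 1 ≤ L) {r : ℕ} {ν₁ ν₂ K₁ K₂ : ℝ} (hν₁ : 0 < ν₁) (hν₂ : 0 < ν₂) (hK₁ : 0 < K₁)
    (hK₂ : 0 < K₂) {f : I → I → I → I} (hf : f ∈ graphonClass H r ν₁ ν₂ K₁ K₂) (ζ : Fin n → I)
    {h : ℕ} (hh : 1 ≤ h) (hn : h + r ≤ n) {ρ : ℝ} (h0 : 0 ≤ ρ) (h1 : ρ ≤ 1) :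
    ∃ c : Candidate n L,
      frobSq (c.theta H - probMatrix L f ζ) ≤
        (n : ℝ) ^ 2 * (2 * (L : ℝ) ^ ρ * (K₁ * 2 ^ (2 * ν₁) / (h : ℝ) ^ (2 * ν₁)) +
          (if ρ < 1 then 1 else 0) * (K₂ / (L : ℝ) ^ (2 * ρ * ν₂))) ∧
      c.penalty ≤ 11 * n * Real.log ((h : ℝ) + r) +
        44 * (((h : ℝ) + r) ^ 2 * (L : ℝ) ^ ρ * (1 + (1 - ρ) * Real.log L)) := by
  obtain ⟨hsymm, β, hβ, hβ0, hβ1, hclass⟩ := hf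
  have hr : 0 < r := by
    rcases Nat.eq_zero_or_pos r with rfl | hr
    · exact absurd (hβ0.symm.trans hβ1) (by norm_num)
    · exact hr
  obtain ⟨z, q, hq, hz⟩ := exists_clustering hβ hβ1 hr hh ζ
  obtain ⟨ρ', hρ', k, hk, hρk, hk2, hkL, hkρ⟩ := exists_mem_rhoSet hL h0 h1
  have hL' : (1 : ℝ) ≤ L := by exact_mod_cast hL
  have hL0 : (0 : ℝ) < L := by linarith
  have hone := Real.one_le_rpow hL' h0
  have hk1 : 1 ≤ k := by exact_mod_cast hone.trans hρk
  have hk0 : (0 : ℝ) < k := by exact_mod_cast hk1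
  have hh0 : (0 : ℝ) < h := by exact_mod_cast hh
  let c : Candidate n L :=
    { m := h + r, one_le_m := by omega, m_le_n := hn, ρ := ρ', rho_mem := hρ', z := z
      V := clusterCoeff H f ζ z k
      V_eq_zero := fun s l hl => by
        rw [hk] at hl
        have hl' : k ≤ (l : ℕ) := by exact_mod_cast hl
        rw [clusterCoeff, Matrix.of_apply, dif_neg fun h => absurd h.1 (by omega)] }
  refine ⟨c, ?_, ?_⟩
  · rw [frobSq_theta_sub_probMatrix hH]
    refine (Finset.sum_le_card_nsmul _ _ _ fun p _ =>
      sum_clusterCoeff_le hsymm hν₁ hν₂ hK₁ hclass hq hz hk1 p).trans ?_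
    rw [nsmul_eq_mul, Finset.card_univ]
    refine mul_le_mul (card_nodePair_le n) (add_le_add ?_ ?_) (by positivity) (by positivity)
    · rw [mul_one_div, Real.div_rpow (by norm_num) hh0.le, ← mul_div_assoc]
      gcongr
    · rcases h1.lt_or_eq with hlt | rfl
      · rw [if_pos hlt, mul_comm (2 : ℝ) ρ, mul_assoc, Real.rpow_mul hL0.le]
        refine mul_le_mul ?_ ?_ (by positivity) one_pos.le
        · split_ifs <;> norm_num
        · gcongr
      · simp [hkρ rfl]
  · have hLk : (L : ℝ) ^ (1 - ρ') ≤ (L : ℝ) ^ (1 - ρ) := by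
      rw [Real.rpow_sub hL0, Real.rpow_sub hL0, hk]
      gcongr
    have hlog : Real.log (25 * (L : ℝ) ^ (1 - ρ')) ≤ 4 + (1 - ρ) * Real.log L := by
      rw [Real.log_mul (by norm_num) (by positivity)]
      have e1 : Real.log 25 ≤ 4 := by
        rw [Real.log_le_iff_le_exp (by norm_num)]
        have e2 : Real.exp 4 = Real.exp 1 ^ 4 := by rw [← Real.exp_nat_mul]; norm_num
        rw [e2]
        calc (25 : ℝ) ≤ 2.7 ^ 4 := by norm_num
          _ ≤ _ := by gcongr; linarith [Real.exp_one_gt_d9]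
      have e3 := Real.log_le_log (by positivity) hLk
      rw [Real.log_rpow hL0 (1 - ρ)] at e3
      linarith
    have hlogL := Real.log_nonneg hL'
    have hb : 0 ≤ (1 - ρ) * Real.log L := mul_nonneg (by linarith) hlogL
    simp only [Candidate.penalty, c, hk, Nat.cast_add]
    refine add_le_add le_rfl ?_
    calc 11 / 2 * ((h : ℝ) + r) ^ 2 * k * Real.log (25 * (L : ℝ) ^ (1 - ρ'))
        ≤ 11 / 2 * ((h : ℝ) + r) ^ 2 * k * (4 + (1 - ρ) * Real.log L) := by gcongr
      _ ≤ 11 / 2 * ((h : ℝ) + r) ^ 2 * (2 * (L : ℝ) ^ ρ) * (4 * (1 + (1 - ρ) * Real.log L)) := by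
          gcongr
          linarith
      _ = _ := by ring

/-! ### Risk bound -/

theorem risk_le {r : ℕ} {ν₁ ν₂ K₁ K₂ : ℝ} (hν₁ : 0 < ν₁) (hν₂ : 0 < ν₂) (hK₁ : 0 < K₁)
    (hK₂ : 0 < K₂) (hL : 1 ≤ L) {H : Matrix (Fin L) (Fin L) ℝ}
    (hH : H ∈ Matrix.orthogonalGroup (Fin L) ℝ) (Pζ : Measure (Fin n → I)) [IsProbabilityMeasure Pζ]
    {est : Obs n L → Tensor n L} (hest : IsEstimator H est) {f : I → I → I → I}
    (hf : f ∈ graphonClass H r ν₁ ν₂ K₁ K₂) {h : ℕ} (hh : 1 ≤ h) (hn : h + r ≤ n) {ρ : ℝ}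
    (h0 : 0 ≤ ρ) (h1 : ρ ≤ 1) :
    risk Pζ f est ≤ ENNReal.ofReal
      ((12 * K₁ * 2 ^ (2 * ν₁) + 6 * K₂ + 176) * rate n L r ν₁ ν₂ h ρ) := by
  have hr : 0 < r := by
    rcases Nat.eq_zero_or_pos r with rfl | hr
    · obtain ⟨-, β, -, hβ0, hβ1, -⟩ := hf
      exact absurd (hβ0.symm.trans hβ1) (by norm_num)
    · exact hr
  have hL' : (1 : ℝ) ≤ L := by exact_mod_cast hL
  have hL0 : (0 : ℝ) < L := by linarith
  have hn1 : (1 : ℝ) ≤ n := by exact_mod_cast (by omega : 1 ≤ n)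
  have hh0 : (0 : ℝ) < h := by exact_mod_cast hh
  have hm2 : (2 : ℝ) ≤ (h : ℝ) + r := by exact_mod_cast (by omega : 2 ≤ h + r)
  have hζ : ∀ ζ, ∫⁻ a, ENNReal.ofReal (tensorNormSq (est a - trueTensor L f ζ) / ((n : ℝ) ^ 2 * L))
      ∂(obsLaw L f ζ) ≤ ENNReal.ofReal
      ((12 * K₁ * 2 ^ (2 * ν₁) + 6 * K₂ + 176) * rate n L r ν₁ ν₂ h ρ) := by
    intro ζ
    have : IsProbabilityMeasure (obsLaw L f ζ) := by unfold obsLaw; infer_instance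
    rw [← ofReal_integral_eq_lintegral_ofReal Integrable.of_finite
      (Filter.Eventually.of_forall fun a => by
        simp only [Pi.zero_apply, tensorNormSq]
        positivity)]
    refine ENNReal.ofReal_le_ofReal ?_
    obtain ⟨c, hc1, hc2⟩ := exists_candidate hH hL hν₁ hν₂ hK₁ hK₂ hf ζ hh hn h0 h1
    have hor := integral_tensorNormSq_le hH hL hf.1 ζ hest c
    rw [integral_div, div_le_iff₀ (by positivity)]
    refine hor.trans ?_
    -- As `h + r ≥ 2`, the labeling term is bounded below and absorbs the additive `8` of the oracle
    -- inequality.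
    have hlog2 : 1 / 2 ≤ Real.log ((h : ℝ) + r) :=
      (by linarith [Real.log_two_gt_d9] : 1 / 2 ≤ Real.log 2).trans
        (Real.log_le_log (by norm_num) hm2)
    have hind : (0 : ℝ) ≤ if ρ < 1 then 1 else 0 := by split_ifs <;> norm_num
    have hb : 0 ≤ (1 - ρ) * Real.log L := mul_nonneg (by linarith) (Real.log_nonneg hL')
    set T₁ := (L : ℝ) ^ ρ / (h : ℝ) ^ (2 * ν₁) with hT₁
    set T₂ := (if ρ < 1 then (1 : ℝ) else 0) / (L : ℝ) ^ (2 * ρ * ν₂) with hT₂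
    set T₃ := ((h : ℝ) + r) ^ 2 * (L : ℝ) ^ ρ * (1 + (1 - ρ) * Real.log L) with hT₃
    set T₄ := n * Real.log ((h : ℝ) + r) with hT₄
    have p1 : 0 ≤ T₁ := by positivity
    have p2 : 0 ≤ T₂ := by positivity
    have p3 : 0 ≤ T₃ := by positivity
    have p4 : 1 / 2 ≤ T₄ := by nlinarith
    have hrate : rate n L r ν₁ ν₂ h ρ * ((n : ℝ) ^ 2 * L) =
        (n : ℝ) ^ 2 * T₁ + (n : ℝ) ^ 2 * T₂ + T₃ + T₄ := by
      rw [rate, hT₁, hT₂, hT₃, hT₄, Real.rpow_sub hL0, Real.rpow_sub hL0, Real.rpow_add hL0,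
        Real.rpow_one]
      field_simp
    have hB : frobSq (c.theta H - probMatrix L f ζ) ≤
        2 * K₁ * 2 ^ (2 * ν₁) * ((n : ℝ) ^ 2 * T₁) + K₂ * ((n : ℝ) ^ 2 * T₂) := by
      refine hc1.trans (le_of_eq ?_)
      rw [hT₁, hT₂]
      ring
    rw [mul_assoc, hrate]
    set A := K₁ * (2 : ℝ) ^ (2 * ν₁) with hA
    have hA0 : 0 ≤ A := by positivity
    set U₁ := (n : ℝ) ^ 2 * T₁
    set U₂ := (n : ℝ) ^ 2 * T₂
    have q1 : 0 ≤ U₁ := by positivity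
    have q2 : 0 ≤ U₂ := by positivity
    rw [mul_assoc (12 : ℝ), ← hA]
    rw [mul_assoc (2 : ℝ), ← hA] at hB
    have q4 : 0 ≤ T₄ := by linarith
    -- The constants come from `12 = 6 · 2`, `6 K₂` and `176 = 4 · 44`; the hints are the
    -- nonnegative cross terms.
    nlinarith [mul_nonneg hA0 q2, mul_nonneg hA0 p3, mul_nonneg hA0 q4, mul_nonneg hK₂.le q1,
      mul_nonneg hK₂.le p3, mul_nonneg hK₂.le q4]
  calc risk Pζ f est ≤ ∫⁻ _, ENNReal.ofReal
        ((12 * K₁ * 2 ^ (2 * ν₁) + 6 * K₂ + 176) * rate n L r ν₁ ν₂ h ρ) ∂Pζ := lintegral_mono hζ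
    _ = _ := by simp

end DynGraphon

theorem theorem6 (ν₁ ν₂ K₁ K₂ : ℝ) (hν₁ : 0 < ν₁) (hν₂ : 0 < ν₂) (hK₁ : 0 < K₁) (hK₂ : 0 < K₂) :
    ∃ C : ℝ, 0 < C ∧
      ∀ (n L r : ℕ), 1 ≤ L →
      ∀ H : Matrix (Fin L) (Fin L) ℝ, H ∈ Matrix.orthogonalGroup (Fin L) ℝ →
      ∀ (Pζ : MeasureTheory.Measure (Fin n → unitInterval))
        [MeasureTheory.IsProbabilityMeasure Pζ],
      ∀ est : DynGraphon.Obs n L → DynGraphon.Tensor n L, DynGraphon.IsEstimator H est →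
        (⨆ f ∈ DynGraphon.graphonClass H r ν₁ ν₂ K₁ K₂, DynGraphon.risk Pζ f est) ≤
          ENNReal.ofReal C *
            ⨅ (h : ℕ) (_ : 1 ≤ h ∧ h + r ≤ n) (ρ : ℝ) (_ : ρ ∈ Set.Icc (0 : ℝ) 1),
              ENNReal.ofReal (DynGraphon.rate n L r ν₁ ν₂ h ρ) := by
  have hC : 0 < 12 * K₁ * 2 ^ (2 * ν₁) + 6 * K₂ + 176 := by positivity
  refine ⟨_, hC, fun n L r hL H hH Pζ _ est hest => iSup₂_le fun f hf => ?_⟩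
  -- Dividing by the constant isolates the infimum, so each `h` and `ρ` can be treated separately.
  rw [mul_comm, ← ENNReal.div_le_iff (by simpa using hC) ENNReal.ofReal_ne_top]
  refine le_iInf₂ fun h hh => le_iInf₂ fun ρ hρ => ?_
  rw [ENNReal.div_le_iff (by simpa using hC) ENNReal.ofReal_ne_top, mul_comm,
    ← ENNReal.ofReal_mul hC.le]
  exact DynGraphon.risk_le hν₁ hν₂ hK₁ hK₂ hL hH Pζ hest hf hh.1 hh.2 hρ.1 hρ.2
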